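/- Let $L,N$ be natural numbers with $L+1<N$, and let $\sigma_1>0$, $\sigma_2\ge 0$, $\rho=\sigma_2/\sigma_1$. Let $\mathbf G\in\mathbb C^{L\times N}$ be a random matrix with independent entries, each of law $\mathcal{CN}(0,\sigma_1^2)$, and let $\mathbf x\sim\mathcal{CN}(0,\sigma_2^2\mathbf I_L)$ be a random vector in $\mathbb C^L$ that is independent of $\mathbf G$. Here $\mathcal{CN}(0,v)$ is the circularly symmetric complex Gaussian law, i.e. the law of a complex random variable whose real and imaginary parts are independent with law $\mathcal N(0,v/2)$, and $\mathcal{CN}(0,v\mathbf I_L)$ is the law of a vector with $L$ independent $\mathcal{CN}(0,v)$ coordinates. Let $\mathbf G^+\in\mathbb C^{N\times L}$ be the Moore–Penrose pseudo-inverse of $\mathbf G$ and $|\cdot|$ the Euclidean norm. Then $|\mathbf G^+\mathbf x|$ is integrable and $$E\left(|\mathbf G^+\mathbf x|\right)\le\sqrt{\frac{L}{N-L-1}}\;\rho .$$ -/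

import Mathlib

open MeasureTheory ProbabilityTheory
open scoped NNReal Matrix

/-- `B` is a Moore–Penrose pseudo-inverse of `A`: the four Penrose equations hold. -/
structure IsMoorePenroseInverse {m n : Type*} [Fintype m] [Fintype n]
    (A : Matrix m n ℂ) (B : Matrix n m ℂ) : Prop where
  mul_mul_left : A * B * A = A
  mul_mul_right : B * A * B = B
  isHermitian_left : (A * B).IsHermitian
  isHermitian_right : (B * A).IsHermitian

/-- A Hermitian matrix has a Hermitian pseudo-inverse that commutes with it. -/
theorem exists_hermitian_pinv {n : Type*} [Fintype n] [DecidableEq n]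
    (H : Matrix n n ℂ) (hH : H.IsHermitian) :
    ∃ P : Matrix n n ℂ, P.IsHermitian ∧ H * P * H = H ∧ P * H * P = P ∧ P * H = H * P := by
  let U : Matrix n n ℂ := hH.eigenvectorUnitary
  let D : Matrix n n ℂ := Matrix.diagonal (fun i => (hH.eigenvalues i : ℂ))
  let E : Matrix n n ℂ := Matrix.diagonal (fun i => ((hH.eigenvalues i)⁻¹ : ℂ))
  have hU : star U * U = 1 := Unitary.coe_star_mul_self hH.eigenvectorUnitary
  have hs : H = U * D * star U := by
    have h := hH.spectral_theorem
    rw [Unitary.conjStarAlgAut_apply] at h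
    exact h
  have hDE : D * E = E * D := by
    simp only [D, E, Matrix.diagonal_mul_diagonal, mul_comm]
  have hDED : D * E * D = D := by
    simp only [D, E, Matrix.diagonal_mul_diagonal, mul_inv_mul_cancel]
  have hEDE : E * D * E = E := by
    simp only [D, E, Matrix.diagonal_mul_diagonal]
    congr 1
    ext i
    simpa using mul_inv_mul_cancel ((hH.eigenvalues i : ℂ)⁻¹)
  have key : ∀ X Y : Matrix n n ℂ,
      (U * X * star U) * (U * Y * star U) = U * (X * Y) * star U := by
    intro X Y
    calc (U * X * star U) * (U * Y * star U) = U * X * (star U * U) * Y * star U := by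
          simp only [Matrix.mul_assoc]
      _ = _ := by rw [hU]; simp only [Matrix.mul_one, Matrix.mul_assoc]
  refine ⟨U * E * star U, ?_, ?_, ?_, ?_⟩
  · have hE : Eᴴ = E := by
      simp only [E, Matrix.diagonal_conjTranspose]
      congr 1
      ext i
      simp
    rw [Matrix.IsHermitian, Matrix.conjTranspose_mul, Matrix.conjTranspose_mul, hE,
      Matrix.star_eq_conjTranspose, Matrix.conjTranspose_conjTranspose, Matrix.mul_assoc]
  · rw [hs, key, key, hDED]
  · rw [hs, key, key, hEDE]
  · rw [hs, key, key, hDE]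

open scoped ComplexOrder in
/-- Every complex matrix has a Moore–Penrose pseudo-inverse. -/
theorem exists_isMoorePenroseInverse {m n : Type*} [Fintype m] [Fintype n]
    (A : Matrix m n ℂ) : ∃ B : Matrix n m ℂ, IsMoorePenroseInverse A B := by
  classical
  obtain ⟨P, hP, h1, h2, h3⟩ :=
    exists_hermitian_pinv (Aᴴ * A) (Matrix.isHermitian_conjTranspose_mul_self A)
  have hP' : Pᴴ = P := hP
  refine ⟨P * Aᴴ, ?_, ?_, ?_, ?_⟩
  · have h0 : (A * P * Aᴴ * A - A)ᴴ * (A * P * Aᴴ * A - A) = 0 := by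
      have e1 : Aᴴ * (A * P * Aᴴ * A - A) = 0 := by
        rw [Matrix.mul_sub, sub_eq_zero]
        simpa only [Matrix.mul_assoc] using h1
      have e2 : (A * P * Aᴴ * A - A)ᴴ = (Aᴴ * A * P - 1) * Aᴴ := by
        simp only [Matrix.conjTranspose_sub, Matrix.conjTranspose_mul,
          Matrix.conjTranspose_conjTranspose, hP', Matrix.sub_mul, Matrix.one_mul,
          Matrix.mul_assoc]
      rw [e2, Matrix.mul_assoc, e1, Matrix.mul_zero]
    have := sub_eq_zero.1 (Matrix.conjTranspose_mul_self_eq_zero.1 h0)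
    simpa only [Matrix.mul_assoc] using this
  · have := congrArg (· * Aᴴ) h2
    simpa only [Matrix.mul_assoc] using this
  · simp only [Matrix.IsHermitian, Matrix.conjTranspose_mul,
      Matrix.conjTranspose_conjTranspose, hP', Matrix.mul_assoc]
  · have e : P * Aᴴ * A = P * (Aᴴ * A) := Matrix.mul_assoc _ _ _
    rw [e, Matrix.IsHermitian, Matrix.conjTranspose_mul, hP', Matrix.conjTranspose_mul,
      Matrix.conjTranspose_conjTranspose, h3]

/-- The Moore–Penrose pseudo-inverse is unique. -/
theorem IsMoorePenroseInverse.unique {m n : Type*} [Fintype m] [Fintype n]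
    {A : Matrix m n ℂ} {B C : Matrix n m ℂ}
    (hB : IsMoorePenroseInverse A B) (hC : IsMoorePenroseInverse A C) : B = C := by
  have hl : A * B = A * C := by
    have h : (A * C * (A * B))ᴴ = A * B * (A * C) := by
      rw [Matrix.conjTranspose_mul, hB.isHermitian_left.eq, hC.isHermitian_left.eq]
    rw [← Matrix.mul_assoc, ← Matrix.mul_assoc, hC.mul_mul_left, hB.mul_mul_left,
      hB.isHermitian_left.eq] at h
    exact h
  have hr : B * A = C * A := by
    have h : (B * A * (C * A))ᴴ = C * A * (B * A) := by
      rw [Matrix.conjTranspose_mul, hB.isHermitian_right.eq, hC.isHermitian_right.eq]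
    rw [Matrix.mul_assoc, Matrix.mul_assoc, ← Matrix.mul_assoc A, ← Matrix.mul_assoc A,
      hC.mul_mul_left, hB.mul_mul_left, hB.isHermitian_right.eq] at h
    exact h
  calc B = B * A * B := hB.mul_mul_right.symm
    _ = C * (A * B) := by rw [hr, Matrix.mul_assoc]
    _ = C := by rw [hl, ← Matrix.mul_assoc, hC.mul_mul_right]

/-- The Moore–Penrose pseudo-inverse `A⁺` of a complex matrix. -/
noncomputable def pinv {m n : Type*} [Fintype m] [Fintype n] (A : Matrix m n ℂ) :
    Matrix n m ℂ :=
  Classical.choose (exists_isMoorePenroseInverse A)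

theorem pinv_spec {m n : Type*} [Fintype m] [Fintype n] (A : Matrix m n ℂ) :
    IsMoorePenroseInverse A (pinv A) :=
  Classical.choose_spec (exists_isMoorePenroseInverse A)

/-- The circularly symmetric complex normal law `CN(0, v)`: the real and imaginary parts are
independent, each with law `N(0, v / 2)`, so that `E |z|² = v`. -/
noncomputable def complexGaussian (v : ℝ≥0) : Measure ℂ :=
  ((gaussianReal 0 (v / 2)).prod (gaussianReal 0 (v / 2))).map
    Complex.measurableEquivRealProd.symm

/-- The law `CN(0, v I)` on `ℂ^ι`: independent coordinates, each with law `CN(0, v)`. -/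
noncomputable def complexGaussianVector (ι : Type*) [Fintype ι] (v : ℝ≥0) : Measure (ι → ℂ) :=
  Measure.pi (fun _ : ι => complexGaussian v)

/-!
By Jensen's inequality it suffices to bound the second moment of `|G⁺ x|`. For a fixed matrix, the
mean over `x` of `|G⁺ x|²` is `σ₂²` times the squared Frobenius norm of `G⁺`
(`lintegral_enorm_mulVec_sq`), so that everything rests on the mean square norm of a column
`G⁺ eᵢ`, one for each `i : Fin L`.

Fix all rows of `G` but the `i`-th. They have a joint kernel of dimension at least `N - L + 1`;
let `B` be a matrix of `m + 1` orthonormal rows from this kernel, where `L + m ≤ N`. Since `G⁺ G`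
is an orthogonal projection, `G⁺ eᵢ` is the shortest solution of `G h = eᵢ` if there is one, and
comparison with an explicit solution built from `B` gives `|G⁺ eᵢ|² ≤ 1 / |B gᵢ|²`
(`sum_enorm_pinv_sq_le`), where `gᵢ` is the `i`-th row. By unitary invariance
(`map_mulVec_complexGaussianVector`) the vector `B gᵢ` consists of `m + 1` independent
`CN(0, σ₁²)` variables, whatever the other rows are, and the mean of the inverse of its square norm
is `1 / (σ₁² m)` (`lintegral_inv_sum_enorm_sq`). With `m = N - L - 1` this yields
`E |G⁺ x|² ≤ σ₂² L / (σ₁² (N - L - 1))`.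

The estimates hold in `[0, ∞]` for every matrix, of full rank or not, since `1 / |B gᵢ|²` is then
allowed to be infinite. The one thing that needs care is that `G ↦ G⁺` is a Borel function
(`measurable_pinv`), which makes Tonelli's theorem available.
-/

open scoped ENNReal

/-! ### The complex Gaussian law and its unitary invariance -/

instance (v : ℝ≥0) : IsProbabilityMeasure (complexGaussian v) :=
  Measure.isProbabilityMeasure_map (by fun_prop)

instance (ι : Type*) [Fintype ι] (v : ℝ≥0) :
    IsProbabilityMeasure (complexGaussianVector ι v) := by
  unfold complexGaussianVector; infer_instance

/-- Independence of the real and the imaginary part. -/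
theorem integral_complexGaussian_mul {𝕜 : Type*} [RCLike 𝕜] (v : ℝ≥0) (f g : ℝ → 𝕜) :
    ∫ z, f z.re * g z.im ∂complexGaussian v =
      (∫ x, f x ∂gaussianReal 0 (v / 2)) * ∫ x, g x ∂gaussianReal 0 (v / 2) := by
  rw [complexGaussian, integral_map_equiv, ← integral_prod_mul]
  rfl

theorem charFunDual_complexGaussian (v : ℝ≥0) (c : ℂ) (ℓ : StrongDual ℝ ℂ)
    (hℓ : ∀ z, ℓ z = (star c * z).re) :
    charFunDual (complexGaussian v) ℓ = Complex.exp (-(v / 4) * (star c * c)) := by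
  have h1 : ∀ z : ℂ, Complex.exp (ℓ z * Complex.I) =
      Complex.exp (c.re * z.re * Complex.I) * Complex.exp (c.im * z.im * Complex.I) := by
    intro z
    rw [← Complex.exp_add, hℓ]
    simp
    ring_nf
  rw [charFunDual_apply]
  simp_rw [h1]
  rw [integral_complexGaussian_mul v (fun x => Complex.exp (c.re * x * Complex.I))
    (fun x => Complex.exp (c.im * x * Complex.I)), ← charFun_apply_real, ← charFun_apply_real,
    charFun_gaussianReal, charFun_gaussianReal, ← Complex.exp_add]
  congr 1
  rw [Complex.star_def, mul_comm, mul_comm ((starRingEnd ℂ) c), Complex.mul_conj,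
    Complex.normSq_apply]
  push_cast
  ring

theorem charFunDual_complexGaussianVector {ι : Type*} [Fintype ι] (v : ℝ≥0) (c : ι → ℂ)
    (ℓ : StrongDual ℝ (ι → ℂ)) (hℓ : ∀ z, ℓ z = (star c ⬝ᵥ z).re) :
    charFunDual (complexGaussianVector ι v) ℓ = Complex.exp (-(v / 4) * (star c ⬝ᵥ c)) := by
  classical
  rw [complexGaussianVector, charFunDual_pi]
  have : ∀ i, charFunDual (complexGaussian v) (ℓ.comp (.single ℝ (fun _ : ι => ℂ) i)) =
      Complex.exp (-(v / 4) * (star (c i) * c i)) := by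
    intro i
    apply charFunDual_complexGaussian
    intro z
    simp [hℓ]
  simp_rw [this]
  rw [← Complex.exp_sum, ← Finset.mul_sum]
  rfl

/-- Every real-linear functional on `ι → ℂ` is the real part of a Hermitian pairing. -/
theorem exists_eq_re_dotProduct {ι : Type*} [Fintype ι] (ℓ : StrongDual ℝ (ι → ℂ)) :
    ∃ c : ι → ℂ, ∀ z, ℓ z = (star c ⬝ᵥ z).re := by
  classical
  refine ⟨fun i => ⟨ℓ (Pi.single i 1), ℓ (Pi.single i Complex.I)⟩, fun z => ?_⟩
  have hz : z = ∑ i,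
      ((z i).re • (Pi.single i 1 : ι → ℂ) + (z i).im • (Pi.single i Complex.I : ι → ℂ)) := by
    ext j
    simp [Finset.sum_apply, Pi.single_apply, Finset.sum_add_distrib]
  conv_lhs => rw [hz]
  simp only [map_sum, map_add, map_smul, dotProduct, Complex.re_sum]
  refine Finset.sum_congr rfl fun i _ => ?_
  simp
  ring

/-- The complex Gaussian law `CN(0, v I)` is invariant under coisometries: coordinates with
respect to an orthonormal family are again independent `CN(0, v)` variables. -/
theorem map_mulVec_complexGaussianVector {ι κ : Type*} [Fintype ι] [Fintype κ] [DecidableEq κ]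
    (v : ℝ≥0) (B : Matrix κ ι ℂ) (hB : B * Bᴴ = 1) :
    (complexGaussianVector ι v).map (fun z => B *ᵥ z) = complexGaussianVector κ v := by
  let T : (ι → ℂ) →L[ℝ] (κ → ℂ) := (B.mulVecLin.restrictScalars ℝ).toContinuousLinearMap
  have hT : ⇑T = fun z => B *ᵥ z := rfl
  rw [← hT]
  have : IsProbabilityMeasure ((complexGaussianVector ι v).map T) :=
    Measure.isProbabilityMeasure_map (by fun_prop)
  apply Measure.ext_of_charFunDual
  ext ℓ
  obtain ⟨c, hc⟩ := exists_eq_re_dotProduct ℓ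
  rw [charFunDual_map, charFunDual_complexGaussianVector v c ℓ hc,
    charFunDual_complexGaussianVector v (Bᴴ *ᵥ c)]
  · congr 2
    rw [Matrix.star_mulVec, Matrix.conjTranspose_conjTranspose, ← Matrix.dotProduct_mulVec,
      Matrix.mulVec_mulVec, hB, Matrix.one_mulVec]
  · intro z
    rw [Matrix.star_mulVec, Matrix.conjTranspose_conjTranspose, ← Matrix.dotProduct_mulVec]
    exact hc _

/-! ### Second moments -/

theorem lintegral_enorm_sq_complexGaussian (v : ℝ≥0) :
    ∫⁻ z, ‖z‖ₑ ^ 2 ∂complexGaussian v = v := by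
  have h1 : ∫⁻ x, ENNReal.ofReal (x ^ 2) ∂gaussianReal 0 (v / 2) = ENNReal.ofReal (v / 2) := by
    have hi : Integrable (fun x : ℝ => x ^ 2) (gaussianReal 0 (v / 2)) :=
      (memLp_id_gaussianReal 2).integrable_sq
    rw [← ofReal_integral_eq_lintegral_ofReal hi (ae_of_all _ fun x => sq_nonneg x)]
    have := variance_of_integral_eq_zero (X := fun x : ℝ => x) (μ := gaussianReal 0 (v / 2))
      (by fun_prop) (by simp)
    rw [variance_fun_id_gaussianReal] at this
    rw [← this]
    simp
  have h2 : ∀ p : ℝ × ℝ, ‖Complex.measurableEquivRealProd.symm p‖ₑ ^ 2 =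
      ENNReal.ofReal (p.1 ^ 2) + ENNReal.ofReal (p.2 ^ 2) := by
    intro p
    rw [← ENNReal.ofReal_add (by positivity) (by positivity), ← ofReal_norm,
      ← ENNReal.ofReal_pow (by positivity), Complex.sq_norm, Complex.normSq_apply]
    simp [sq]
  rw [complexGaussian, lintegral_map_equiv]
  simp_rw [h2]
  rw [lintegral_add_left (by fun_prop), lintegral_prod _ (by fun_prop),
    lintegral_prod _ (by fun_prop)]
  simp only [lintegral_const, measure_univ, mul_one, h1]
  rw [← ENNReal.ofReal_add (by positivity) (by positivity), add_halves, ENNReal.ofReal_coe_nnreal]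

theorem lintegral_eval_complexGaussianVector {ι : Type*} [Fintype ι] (v : ℝ≥0) (i : ι)
    (f : ℂ → ℝ≥0∞) (hf : Measurable f) :
    ∫⁻ z, f (z i) ∂complexGaussianVector ι v = ∫⁻ z, f z ∂complexGaussian v :=
  (measurePreserving_eval (fun _ : ι => complexGaussian v) i).lintegral_comp hf

theorem enorm_toLp_sq {ι : Type*} [Fintype ι] (z : ι → ℂ) :
    ‖(WithLp.toLp 2 z : EuclideanSpace ℂ ι)‖ₑ ^ 2 = ∑ i, ‖z i‖ₑ ^ 2 := by
  simp_rw [← ofReal_norm, ← ENNReal.ofReal_pow (norm_nonneg _)]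
  rw [← ENNReal.ofReal_sum_of_nonneg (fun _ _ => by positivity), EuclideanSpace.norm_sq_eq]

theorem measurable_mulVec {ι κ : Type*} [Fintype ι] [Fintype κ] (B : Matrix κ ι ℂ) :
    Measurable fun z : ι → ℂ => B *ᵥ z :=
  (continuous_const.matrix_mulVec continuous_id).measurable

/-- The second moment of a linear form in a Gaussian vector. After scaling, `a` is a single
orthonormal row, so that the form has the law of one coordinate. -/
theorem lintegral_enorm_dotProduct_sq {ι : Type*} [Fintype ι] (v : ℝ≥0) (a : ι → ℂ) :
    ∫⁻ z, ‖a ⬝ᵥ z‖ₑ ^ 2 ∂complexGaussianVector ι v = v * ∑ i, ‖a i‖ₑ ^ 2 := by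
  rcases eq_or_ne a 0 with rfl | ha
  · simp
  set r : ℝ := ‖(WithLp.toLp 2 a : EuclideanSpace ℂ ι)‖ with hr
  have hr0 : r ≠ 0 := by
    rw [hr, norm_ne_zero_iff]
    simpa using ha
  have hrsq : (r : ℂ) ^ 2 = ∑ i, a i * star (a i) := by
    rw [hr, ← Complex.ofReal_pow, EuclideanSpace.norm_sq_eq]
    push_cast
    refine Finset.sum_congr rfl fun i _ => ?_
    rw [Complex.star_def, Complex.mul_conj, Complex.normSq_eq_norm_sq]
    push_cast; rfl
  have hrC : (r : ℂ) ≠ 0 := by exact_mod_cast hr0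
  let B : Matrix Unit ι ℂ := fun _ i => (r : ℂ)⁻¹ * a i
  have hB : B * Bᴴ = 1 := by
    ext p q
    have : ∑ i, (r : ℂ)⁻¹ * a i * star ((r : ℂ)⁻¹ * a i) =
        (r : ℂ)⁻¹ ^ 2 * ∑ i, a i * star (a i) := by
      rw [Finset.mul_sum]
      refine Finset.sum_congr rfl fun i _ => ?_
      simp; ring
    refine this.trans ?_
    rw [← hrsq, Subsingleton.elim q p, Matrix.one_apply_eq, ← mul_pow, inv_mul_cancel₀ hrC,
      one_pow]
  have hz : ∀ z, ‖a ⬝ᵥ z‖ₑ ^ 2 = ‖(r : ℂ)‖ₑ ^ 2 * ‖(B *ᵥ z) ()‖ₑ ^ 2 := by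
    intro z
    rw [← mul_pow, ← enorm_mul]
    congr 2
    simp only [Matrix.mulVec, dotProduct, B, Finset.mul_sum]
    refine Finset.sum_congr rfl fun i _ => ?_
    field_simp
  simp_rw [hz]
  have hBm := measurable_mulVec B
  rw [lintegral_const_mul _ (by fun_prop),
    ← lintegral_map (μ := complexGaussianVector ι v) (f := fun y : Unit → ℂ => ‖y ()‖ₑ ^ 2)
      (g := fun z => B *ᵥ z) (by fun_prop) hBm,
    map_mulVec_complexGaussianVector v B hB,
    lintegral_eval_complexGaussianVector v () (fun z => ‖z‖ₑ ^ 2) (by fun_prop),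
    lintegral_enorm_sq_complexGaussian, mul_comm, ← enorm_toLp_sq]
  congr 2
  rw [← ofReal_norm, ← ofReal_norm, Complex.norm_real, hr, norm_norm]

/-! ### The mean of the inverse square norm -/

theorem integral_exp_neg_mul_sq_gaussianReal {w : ℝ≥0} (hw : w ≠ 0) {t : ℝ} (ht : 0 ≤ t) :
    ∫ x, Real.exp (-(t * x ^ 2)) ∂gaussianReal 0 w = (√(1 + 2 * w * t))⁻¹ := by
  have hw' : (0 : ℝ) < w := by exact_mod_cast pos_iff_ne_zero.2 hw
  rw [integral_gaussianReal_eq_integral_smul hw]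
  have h : ∀ x : ℝ, gaussianPDFReal 0 w x • Real.exp (-(t * x ^ 2)) =
      (√(2 * Real.pi * w))⁻¹ * Real.exp (-(t + 1 / (2 * w)) * x ^ 2) := by
    intro x
    rw [gaussianPDFReal, smul_eq_mul, mul_assoc, ← Real.exp_add]
    congr 2
    ring
  simp_rw [h]
  rw [integral_const_mul, integral_gaussian, ← Real.sqrt_inv, ← Real.sqrt_inv,
    ← Real.sqrt_mul (by positivity)]
  congr 1
  field_simp
  ring

theorem integral_exp_neg_mul_normSq_complexGaussian {v : ℝ≥0} (hv : v ≠ 0) {t : ℝ} (ht : 0 ≤ t) :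
    ∫ z, Real.exp (-(t * Complex.normSq z)) ∂complexGaussian v = (1 + v * t)⁻¹ := by
  have h : ∀ z : ℂ, Real.exp (-(t * Complex.normSq z)) =
      Real.exp (-(t * z.re ^ 2)) * Real.exp (-(t * z.im ^ 2)) := by
    intro z
    rw [← Real.exp_add, Complex.normSq_apply]
    congr 1
    ring
  simp_rw [h]
  rw [integral_complexGaussian_mul v (fun x => Real.exp (-(t * x ^ 2)))
    (fun x => Real.exp (-(t * x ^ 2))),
    integral_exp_neg_mul_sq_gaussianReal (by simpa using hv) ht, ← mul_inv,
    Real.mul_self_sqrt (by positivity)]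
  push_cast
  congr 2
  ring

theorem lintegral_exp_neg_mul_sum_normSq {ι : Type*} [Fintype ι] {v : ℝ≥0} (hv : v ≠ 0) {t : ℝ}
    (ht : 0 ≤ t) :
    ∫⁻ y, ENNReal.ofReal (Real.exp (-(t * ∑ i, Complex.normSq (y i))))
      ∂complexGaussianVector ι v = ENNReal.ofReal ((1 + v * t)⁻¹ ^ Fintype.card ι) := by
  have hmeas : Measurable fun y : ι → ℂ => Real.exp (-(t * ∑ i, Complex.normSq (y i))) := by
    have := Complex.continuous_normSq
    fun_prop
  have hnn : ∀ y : ι → ℂ, 0 ≤ t * ∑ i, Complex.normSq (y i) := fun y =>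
    mul_nonneg ht (Finset.sum_nonneg fun _ _ => Complex.normSq_nonneg _)
  rw [← ofReal_integral_eq_lintegral_ofReal _ (ae_of_all _ fun _ => (Real.exp_pos _).le)]
  · congr 1
    simp_rw [Finset.mul_sum, ← Finset.sum_neg_distrib, Real.exp_sum]
    rw [complexGaussianVector,
      integral_fintype_prod_eq_pow (fun z : ℂ => Real.exp (-(t * Complex.normSq z))),
      integral_exp_neg_mul_normSq_complexGaussian hv ht]
  · refine Integrable.of_bound hmeas.aestronglyMeasurable 1 (ae_of_all _ fun y => ?_)
    rw [Real.norm_of_nonneg (Real.exp_pos _).le, Real.exp_le_one_iff]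
    linarith [hnn y]

/-- The Laplace representation of the inverse; both sides are `∞` at `s = 0`. -/
theorem inv_ofReal_eq_lintegral_exp {s : ℝ} (hs : 0 ≤ s) :
    (ENNReal.ofReal s)⁻¹ = ∫⁻ t in Set.Ioi (0 : ℝ), ENNReal.ofReal (Real.exp (-(t * s))) := by
  rcases hs.eq_or_lt with rfl | hs
  · simp
  · have h1 := integrableOn_exp_mul_Ioi (a := -s) (by linarith) 0
    have h2 := integral_exp_mul_Ioi (a := -s) (by linarith) 0
    have h3 : ∀ t : ℝ, -(t * s) = -s * t := fun t => by ring
    simp_rw [h3]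
    rw [← ofReal_integral_eq_lintegral_ofReal h1 (ae_of_all _ fun _ => (Real.exp_pos _).le), h2,
      ← ENNReal.ofReal_inv_of_pos hs]
    simp

theorem lintegral_inv_one_add_mul_pow {v : ℝ} (hv : 0 < v) {m : ℕ} (hm : m ≠ 0) :
    ∫⁻ t in Set.Ioi (0 : ℝ), ENNReal.ofReal ((1 + v * t)⁻¹ ^ (m + 1)) =
      ENNReal.ofReal (1 / (v * m)) := by
  have hm' : (0 : ℝ) < m := by exact_mod_cast Nat.pos_of_ne_zero hm
  have hpos : ∀ t ∈ Set.Ici (0 : ℝ), 0 < 1 + v * t := fun t ht => by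
    have : 0 ≤ t := ht
    positivity
  have hd : ∀ t ∈ Set.Ici (0 : ℝ), HasDerivAt (fun t => -(1 / (v * m)) * (1 + v * t)⁻¹ ^ m)
      ((1 + v * t)⁻¹ ^ (m + 1)) t := by
    intro t ht
    have h0 := (hpos t ht).ne'
    have h1 : HasDerivAt (fun t : ℝ => 1 + v * t) v t := by
      simpa using ((hasDerivAt_id t).const_mul v).const_add 1
    refine (((h1.inv h0).pow m).const_mul (-(1 / (v * m)))).congr_deriv ?_
    obtain ⟨k, rfl⟩ := Nat.exists_eq_succ_of_ne_zero hm
    simp only [Nat.succ_eq_add_one, Nat.add_sub_cancel, Pi.inv_apply] at *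
    rw [add_assoc, pow_add _ k (1 + 1)]
    generalize (1 + v * t)⁻¹ ^ k = q
    rw [one_add_one_eq_two, inv_pow]
    field_simp
  have hlim : Filter.Tendsto (fun t : ℝ => -(1 / (v * m)) * (1 + v * t)⁻¹ ^ m) Filter.atTop
      (nhds 0) := by
    have h1 : Filter.Tendsto (fun t : ℝ => (1 + v * t)⁻¹) Filter.atTop (nhds 0) :=
      (Filter.tendsto_atTop_add_const_left _ 1
        (Filter.tendsto_id.const_mul_atTop hv)).inv_tendsto_atTop
    simpa [hm] using (h1.pow m).const_mul (-(1 / (v * m)))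
  have hnn : ∀ t ∈ Set.Ioi (0 : ℝ), 0 ≤ (1 + v * t)⁻¹ ^ (m + 1) := fun t ht =>
    pow_nonneg (inv_nonneg.2 (hpos t (Set.Ioi_subset_Ici_self ht)).le) _
  have hint := integrableOn_Ioi_deriv_of_nonneg' hd hnn hlim
  rw [← ofReal_integral_eq_lintegral_ofReal hint
    ((ae_restrict_iff' measurableSet_Ioi).2 (ae_of_all _ hnn)),
    integral_Ioi_of_hasDerivAt_of_nonneg' hd hnn hlim]
  simp

/-- The mean of the inverse square norm of a complex Gaussian vector in dimension `m + 1 ≥ 2`: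
the square norm has a Gamma law with shape `m + 1`, and Laplace transform `(1 + v t) ^ (-(m + 1))`,
which is integrated over `t > 0`. -/
theorem lintegral_inv_sum_enorm_sq {m : ℕ} (hm : m ≠ 0) {v : ℝ≥0} (hv : v ≠ 0) :
    ∫⁻ y, (∑ i, ‖y i‖ₑ ^ 2)⁻¹ ∂complexGaussianVector (Fin (m + 1)) v =
      ENNReal.ofReal (1 / (v * m)) := by
  have hv' : (0 : ℝ) < v := by exact_mod_cast pos_iff_ne_zero.2 hv
  have h : ∀ y : Fin (m + 1) → ℂ, (∑ i, ‖y i‖ₑ ^ 2)⁻¹ =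
      ∫⁻ t in Set.Ioi (0 : ℝ), ENNReal.ofReal (Real.exp (-(t * ∑ i, Complex.normSq (y i)))) := by
    intro y
    rw [← inv_ofReal_eq_lintegral_exp (Finset.sum_nonneg fun _ _ => Complex.normSq_nonneg _),
      ENNReal.ofReal_sum_of_nonneg fun _ _ => Complex.normSq_nonneg _]
    simp_rw [Complex.normSq_eq_norm_sq, ENNReal.ofReal_pow (norm_nonneg _), ofReal_norm]
  simp_rw [h]
  have := Complex.continuous_normSq
  rw [lintegral_lintegral_swap]
  · rw [← lintegral_inv_one_add_mul_pow hv' hm]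
    refine setLIntegral_congr_fun measurableSet_Ioi fun t ht => ?_
    simpa using lintegral_exp_neg_mul_sum_normSq (ι := Fin (m + 1)) hv (le_of_lt ht)
  · apply Measurable.aemeasurable
    apply ENNReal.measurable_ofReal.comp
    apply Continuous.measurable
    fun_prop

/-! ### Norms of the columns of the pseudo-inverse -/

/-- A wide matrix `A` admits orthonormal vectors, the rows of `B`, in the kernel of `A`. -/
theorem exists_orthonormal_rows_mul_transpose_eq_zero {m n : Type*} [Fintype m]
    [Fintype n] (A : Matrix m n ℂ) (k : ℕ)
    (h : Fintype.card m + k ≤ Fintype.card n) :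
    ∃ B : Matrix (Fin k) n ℂ, B * Bᴴ = 1 ∧ A * Bᵀ = 0 := by
  classical
  let T : EuclideanSpace ℂ n →ₗ[ℂ] (m → ℂ) :=
    A.mulVecLin ∘ₗ (WithLp.linearEquiv 2 ℂ (n → ℂ)).toLinearMap
  have hT : ∀ u, T u = A *ᵥ u.ofLp := fun _ => rfl
  have h1 := T.finrank_range_add_finrank_ker
  have h2 : Module.finrank ℂ (LinearMap.range T) ≤ Fintype.card m :=
    (Submodule.finrank_le _).trans_eq (Module.finrank_fintype_fun_eq_card ℂ)
  rw [finrank_euclideanSpace] at h1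
  have hk : k ≤ Module.finrank ℂ (LinearMap.ker T) := by omega
  let b := stdOrthonormalBasis ℂ (LinearMap.ker T)
  refine ⟨fun i => (b (Fin.castLE hk i) : EuclideanSpace ℂ n).ofLp, ?_, ?_⟩
  · ext i j
    have := orthonormal_iff_ite.1 b.orthonormal (Fin.castLE hk j) (Fin.castLE hk i)
    rw [Submodule.coe_inner, EuclideanSpace.inner_eq_star_dotProduct] at this
    refine Eq.trans this ?_
    simp [Matrix.one_apply, eq_comm]
  · ext r i
    have := (b (Fin.castLE hk i)).2
    rw [LinearMap.mem_ker, hT] at this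
    exact congrFun this r

theorem star_dotProduct_self_eq {ι : Type*} [Fintype ι] (z : ι → ℂ) :
    star z ⬝ᵥ z = ((‖(WithLp.toLp 2 z : EuclideanSpace ℂ ι)‖ ^ 2 : ℝ) : ℂ) := by
  rw [EuclideanSpace.norm_sq_eq]
  push_cast
  refine Finset.sum_congr rfl fun i _ => ?_
  rw [Pi.star_apply, Complex.star_def, mul_comm, Complex.mul_conj, Complex.normSq_eq_norm_sq]
  push_cast
  rfl

/-- `A⁺ A` is an orthogonal projection, hence a contraction: `A⁺ (A u)` is the solution of
minimal norm of `A h = A u`. -/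
theorem norm_pinv_mulVec_mulVec_le {m n : Type*} [Fintype m] [Fintype n] (A : Matrix m n ℂ)
    (u : n → ℂ) :
    ‖(WithLp.toLp 2 (pinv A *ᵥ (A *ᵥ u)) : EuclideanSpace ℂ n)‖ ≤
      ‖(WithLp.toLp 2 u : EuclideanSpace ℂ n)‖ := by
  have hA := pinv_spec A
  set Q := pinv A * A with hQ
  have hQh : Qᴴ = Q := hA.isHermitian_right
  have hQQ : Q * Q = Q := by
    rw [hQ, ← Matrix.mul_assoc, hA.mul_mul_right]
  rw [Matrix.mulVec_mulVec, ← hQ]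
  have h1 : star (Q *ᵥ u) ⬝ᵥ (u - Q *ᵥ u) = 0 := by
    rw [Matrix.star_mulVec, hQh, ← Matrix.dotProduct_mulVec, Matrix.mulVec_sub,
      Matrix.mulVec_mulVec, hQQ, sub_self, dotProduct_zero]
  have h2 := norm_add_sq_eq_norm_sq_add_norm_sq_of_inner_eq_zero (𝕜 := ℂ)
    (WithLp.toLp 2 (Q *ᵥ u) : EuclideanSpace ℂ n) (WithLp.toLp 2 (u - Q *ᵥ u)) (by
      rw [EuclideanSpace.inner_eq_star_dotProduct, dotProduct_comm]
      exact h1)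
  rw [← WithLp.toLp_add, add_sub_cancel] at h2
  nlinarith [norm_nonneg (WithLp.toLp 2 u : EuclideanSpace ℂ n),
    norm_nonneg (WithLp.toLp 2 (Q *ᵥ u) : EuclideanSpace ℂ n),
    norm_nonneg (WithLp.toLp 2 (u - Q *ᵥ u) : EuclideanSpace ℂ n)]

/-- If the rows of `B` are orthonormal and annihilated by all rows of `A` but the `i`-th, then the
`i`-th column of `A⁺` has norm at most `1 / ‖B aᵢ‖`, where `aᵢ` is the `i`-th row: the vector
`u = Bᵀ (B aᵢ)̄` satisfies `A u = ‖B aᵢ‖² eᵢ` and `‖u‖ = ‖B aᵢ‖`. -/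
theorem sum_enorm_pinv_sq_le {m n : Type*} [Fintype m] [Fintype n] {k : ℕ}
    (A : Matrix m n ℂ) (i : m) (B : Matrix (Fin k) n ℂ) (hB : B * Bᴴ = 1)
    (hAB : ∀ j ≠ i, B *ᵥ A j = 0) :
    ∑ l, ‖pinv A l i‖ₑ ^ 2 ≤ (∑ l, ‖(B *ᵥ A i) l‖ₑ ^ 2)⁻¹ := by
  classical
  set y := B *ᵥ A i with hy
  set r : ℝ := ‖(WithLp.toLp 2 y : EuclideanSpace ℂ (Fin k))‖ with hr
  set u : n → ℂ := star y ᵥ* B with hu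
  set h : EuclideanSpace ℂ n := WithLp.toLp 2 (fun l => pinv A l i) with hh
  have hAu : A *ᵥ u = ((r ^ 2 : ℝ) : ℂ) • Pi.single i 1 := by
    ext j
    have e : (A *ᵥ u) j = star y ⬝ᵥ (B *ᵥ A j) := by
      rw [Matrix.dotProduct_mulVec, dotProduct_comm]
      rfl
    rcases eq_or_ne j i with rfl | hj
    · rw [e, ← hy, star_dotProduct_self_eq]
      simp [hr]
    · rw [e, hAB j hj]
      simp [hj]
  have hnu : ‖(WithLp.toLp 2 u : EuclideanSpace ℂ n)‖ ^ 2 = r ^ 2 := by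
    have h1 := star_dotProduct_self_eq u
    have h2 := star_dotProduct_self_eq y
    have h3 : star u ⬝ᵥ u = star y ⬝ᵥ y := by
      rw [hu, Matrix.star_vecMul, star_star, dotProduct_comm, ← Matrix.dotProduct_mulVec,
        Matrix.mulVec_mulVec, hB, Matrix.one_mulVec]
    rw [h3, h2] at h1
    exact_mod_cast h1.symm
  have hle := norm_pinv_mulVec_mulVec_le A u
  have hcol : (WithLp.toLp 2 (pinv A *ᵥ (A *ᵥ u)) : EuclideanSpace ℂ n) =
      ((r ^ 2 : ℝ) : ℂ) • h := by
    rw [hAu, Matrix.mulVec_smul, Matrix.mulVec_single_one]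
    rfl
  rw [hcol, norm_smul, Complex.norm_real, Real.norm_of_nonneg (sq_nonneg r)] at hle
  have hnu' : ‖(WithLp.toLp 2 u : EuclideanSpace ℂ n)‖ = r :=
    (sq_eq_sq₀ (norm_nonneg _) (norm_nonneg _)).1 hnu
  rw [hnu'] at hle
  rw [← enorm_toLp_sq y, ← enorm_toLp_sq (fun l => pinv A l i), ← hh, ← ofReal_norm, ← ofReal_norm,
    ← hr, ← ENNReal.ofReal_pow (norm_nonneg _), ← ENNReal.ofReal_pow (norm_nonneg _)]
  rcases (norm_nonneg _ : 0 ≤ r).eq_or_lt with h0 | h0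
  · simp [← h0]
  · rw [← ENNReal.ofReal_inv_of_pos (by positivity)]
    apply ENNReal.ofReal_le_ofReal
    have : r * ‖h‖ ≤ 1 := by
      by_contra! hc
      nlinarith
    rw [← one_div, le_div_iff₀ (by positivity), ← mul_pow, mul_comm]
    exact pow_le_one₀ (by positivity) this

/-! ### Measurability of the pseudo-inverse -/

/-- The pseudo-inverse is a Borel function, although it is not continuous: the graph
`{(A, B) | B = A⁺}` is closed, and so the preimage of a closed set `C` is the union over `r` of
the projections of the closed sets `{(A, B) | B = A⁺, B ∈ C, ‖B‖ ≤ r}`, which are closed since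
`B` ranges over a compact set. -/
theorem measurable_pinv {m n : Type*} [Fintype m] [Fintype n] :
    Measurable fun (A : m → n → ℂ) (j : n) (i : m) => pinv (Matrix.of A) j i := by
  apply measurable_of_isClosed
  intro C hC
  have hgraph : IsClosed {p : (n → m → ℂ) × (m → n → ℂ) |
      IsMoorePenroseInverse (Matrix.of p.2) (Matrix.of p.1)} := by
    have h1 : Continuous fun p : (n → m → ℂ) × (m → n → ℂ) => (Matrix.of p.1 : Matrix n m ℂ) :=
      continuous_fst
    have h2 : Continuous fun p : (n → m → ℂ) × (m → n → ℂ) => (Matrix.of p.2 : Matrix m n ℂ) :=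
      continuous_snd
    have : {p : (n → m → ℂ) × (m → n → ℂ) |
        IsMoorePenroseInverse (Matrix.of p.2) (Matrix.of p.1)} =
        {p | Matrix.of p.2 * Matrix.of p.1 * Matrix.of p.2 = Matrix.of p.2} ∩
        {p | Matrix.of p.1 * Matrix.of p.2 * Matrix.of p.1 = Matrix.of p.1} ∩
        {p | (Matrix.of p.2 * Matrix.of p.1)ᴴ = Matrix.of p.2 * Matrix.of p.1} ∩
        {p | (Matrix.of p.1 * Matrix.of p.2)ᴴ = Matrix.of p.1 * Matrix.of p.2} := by
      ext p
      exact ⟨fun h => ⟨⟨⟨h.1, h.2⟩, h.3⟩, h.4⟩, fun h => ⟨h.1.1.1, h.1.1.2, h.1.2, h.2⟩⟩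
    rw [this]
    refine ((IsClosed.inter ?_ ?_).inter ?_).inter ?_ <;> refine isClosed_eq ?_ ?_
    · exact (h2.matrix_mul h1).matrix_mul h2
    · exact h2
    · exact (h1.matrix_mul h2).matrix_mul h1
    · exact h1
    · exact (h2.matrix_mul h1).matrix_conjTranspose
    · exact h2.matrix_mul h1
    · exact (h1.matrix_mul h2).matrix_conjTranspose
    · exact h1.matrix_mul h2
  have hpre : (fun (A : m → n → ℂ) (j : n) (i : m) => pinv (Matrix.of A) j i) ⁻¹' C =
      ⋃ r : ℕ, (fun p : Metric.closedBall (0 : n → m → ℂ) r × (m → n → ℂ) => p.2) ''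
        {p | IsMoorePenroseInverse (Matrix.of p.2) (Matrix.of p.1.1) ∧ p.1.1 ∈ C} := by
    ext A
    simp only [Set.mem_preimage, Set.mem_iUnion, Set.mem_image, Set.mem_ofPred_eq]
    constructor
    · intro hA
      obtain ⟨r, hr⟩ := exists_nat_ge ‖(fun j i => pinv (Matrix.of A) j i : n → m → ℂ)‖
      exact ⟨r, (⟨_, mem_closedBall_zero_iff.2 hr⟩, A), ⟨pinv_spec _, hA⟩, rfl⟩
    · rintro ⟨r, ⟨B, A'⟩, ⟨hB, hC⟩, rfl⟩
      rw [(pinv_spec _).unique hB]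
      exact hC
  rw [hpre]
  refine MeasurableSet.iUnion fun r => IsClosed.measurableSet ?_
  have : CompactSpace (Metric.closedBall (0 : n → m → ℂ) r) :=
    isCompact_iff_compactSpace.1 (isCompact_closedBall _ _)
  refine isClosedMap_snd_of_compactSpace _ (IsClosed.inter ?_ ?_)
  · exact hgraph.preimage (by fun_prop : Continuous fun
      p : Metric.closedBall (0 : n → m → ℂ) r × (m → n → ℂ) => (p.1.1, p.2))
  · exact hC.preimage (by fun_prop : Continuous fun
      p : Metric.closedBall (0 : n → m → ℂ) r × (m → n → ℂ) => p.1.1)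

/-! ### Product measures -/

/-- A bound on the integral over one coordinate, uniform in the other coordinates, bounds the whole
integral. The hypothesis asks nothing of the dependence on the other coordinates, so the bound may
be proved with choices that are not measurable in them. -/
theorem lintegral_pi_le_of_update {ι : Type*} [Fintype ι] [DecidableEq ι] {X : ι → Type*}
    [∀ i, MeasurableSpace (X i)] (μ : ∀ i, Measure (X i)) [∀ i, IsProbabilityMeasure (μ i)]
    (i : ι) {f : (∀ j, X j) → ℝ≥0∞} (hf : Measurable f) {C : ℝ≥0∞}
    (h : ∀ x, ∫⁻ y, f (Function.update x i y) ∂μ i ≤ C) : ∫⁻ x, f x ∂Measure.pi μ ≤ C := by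
  have : ∀ j, Nonempty (X j) := fun j => nonempty_of_isProbabilityMeasure (μ j)
  have x : ∀ j, X j := fun j => Classical.arbitrary _
  rw [lintegral_eq_lmarginal_univ x, lmarginal_erase' f hf (Finset.mem_univ i)]
  refine (lmarginal_mono (g := fun _ => C) h x).trans ?_
  simp [lmarginal]

theorem map_curry_pi {ι κ X : Type*} [Fintype ι] [Fintype κ] [MeasurableSpace X]
    (μ : Measure X) [SigmaFinite μ] :
    (Measure.pi fun _ : ι × κ => μ).map (fun f i j => f (i, j)) =
      Measure.pi fun _ : ι => Measure.pi fun _ : κ => μ := by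
  let e := MeasurableEquiv.curry ι κ X
  have h : (Measure.pi fun _ : ι => Measure.pi fun _ : κ => μ).map e.symm =
      Measure.pi fun _ : ι × κ => μ := by
    symm
    refine Measure.pi_eq fun s _ => ?_
    rw [e.symm.map_apply]
    have : e.symm ⁻¹' Set.univ.pi s = Set.univ.pi fun i => Set.univ.pi fun j => s (i, j) := by
      ext f
      simp only [Set.mem_preimage, Set.mem_univ_pi, Prod.forall]
      rfl
    rw [this, Measure.pi_pi]
    simp_rw [Measure.pi_pi]
    rw [Fintype.prod_prod_type]
  rw [← h]
  change Measure.map e _ = _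
  rw [Measure.map_map e.measurable e.symm.measurable, MeasurableEquiv.self_comp_symm,
    Measure.map_id]

/-! ### The moments of the pseudo-inverse of a Gaussian matrix -/

/-- The mean square norm of a column of the pseudo-inverse. Given the rows of `A` other than the
`i`-th, the projection of the `i`-th row to the orthogonal complement of the others contains
`m + 1` independent Gaussian coordinates, and the square norm of the column is at most the inverse
of the sum of their squares. -/
theorem lintegral_sum_enorm_pinv_sq_le {L N m : ℕ} (hm : m ≠ 0) (hmN : L + m ≤ N) {v : ℝ≥0}
    (hv : v ≠ 0) (i : Fin L) :
    ∫⁻ A, ∑ l, ‖pinv (Matrix.of A) l i‖ₑ ^ 2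
        ∂Measure.pi (fun _ : Fin L => complexGaussianVector (Fin N) v) ≤
      ENNReal.ofReal (1 / (v * m)) := by
  have hpm := measurable_pinv (m := Fin L) (n := Fin N)
  have hpm' : ∀ l, Measurable fun A : Fin L → Fin N → ℂ => pinv (Matrix.of A) l i := fun l =>
    (measurable_pi_apply i).comp ((measurable_pi_apply l).comp hpm)
  refine lintegral_pi_le_of_update _ i (by fun_prop) fun A => ?_
  have hcard : Fintype.card {j // j ≠ i} + (m + 1) ≤ Fintype.card (Fin N) := by
    have := i.pos
    simp only [ne_eq, Fintype.card_subtype_compl, Fintype.card_fin, Fintype.card_unique]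
    omega
  obtain ⟨B, hB, hAB⟩ := exists_orthonormal_rows_mul_transpose_eq_zero
    (Matrix.of fun (j : {j // j ≠ i}) => A j) (m + 1) hcard
  have hBA : ∀ g, ∀ j ≠ i, B *ᵥ Matrix.of (Function.update A i g) j = 0 := by
    intro g j hj
    ext r
    have := congrFun (congrFun hAB ⟨j, hj⟩) r
    rw [Matrix.mul_apply] at this
    change ∑ l, B r l * Function.update A i g j l = 0
    rw [Function.update_of_ne hj]
    exact (Finset.sum_congr rfl fun l _ => mul_comm _ _).trans this
  calc _ ≤ ∫⁻ g, (∑ l, ‖(B *ᵥ g) l‖ₑ ^ 2)⁻¹ ∂complexGaussianVector (Fin N) v := by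
        refine lintegral_mono fun g => ?_
        have := sum_enorm_pinv_sq_le (Matrix.of (Function.update A i g)) i B hB (hBA g)
        have e : Matrix.of (Function.update A i g) i = g := Function.update_self ..
        rwa [e] at this
    _ = ∫⁻ y, (∑ l, ‖y l‖ₑ ^ 2)⁻¹ ∂complexGaussianVector (Fin (m + 1)) v := by
        rw [← map_mulVec_complexGaussianVector v B hB,
          lintegral_map (by fun_prop) (measurable_mulVec B)]
    _ = _ := lintegral_inv_sum_enorm_sq hm hv

theorem lintegral_enorm_mulVec_sq {ι κ : Type*} [Fintype ι] [Fintype κ] (v : ℝ≥0)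
    (M : Matrix κ ι ℂ) :
    ∫⁻ z, ‖(WithLp.toLp 2 (M *ᵥ z) : EuclideanSpace ℂ κ)‖ₑ ^ 2 ∂complexGaussianVector ι v =
      v * ∑ i, ∑ l, ‖M l i‖ₑ ^ 2 := by
  have hM := measurable_mulVec M
  simp_rw [enorm_toLp_sq]
  rw [lintegral_finsetSum _ fun l _ => by fun_prop, Finset.sum_comm, Finset.mul_sum]
  exact Finset.sum_congr rfl fun l _ => lintegral_enorm_dotProduct_sq v (M l)

theorem measurable_pinv_mulVec {m n : Type*} [Fintype m] [Fintype n] :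
    Measurable fun p : (m → n → ℂ) × (m → ℂ) =>
      (WithLp.toLp 2 (pinv (Matrix.of p.1) *ᵥ p.2) : EuclideanSpace ℂ n) := by
  have hpm := measurable_pinv (m := m) (n := n)
  refine (WithLp.measurable_toLp 2 (n → ℂ)).comp (measurable_pi_lambda _ fun j => ?_)
  have hpm' : ∀ i, Measurable fun p : (m → n → ℂ) × (m → ℂ) => pinv (Matrix.of p.1) j i := fun i =>
    (measurable_pi_apply i).comp ((measurable_pi_apply j).comp (hpm.comp measurable_fst))
  simp only [Matrix.mulVec, dotProduct]
  fun_prop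

/-- The second moment of `‖A⁺ x‖` for independent Gaussian `A` and `x`: integrating over `x` first
leaves `w` times the mean square Frobenius norm of `A⁺`, a sum of `L` column norms. -/
theorem lintegral_enorm_pinv_mulVec_sq_le {L N m : ℕ} (hm : m ≠ 0) (hmN : L + m ≤ N)
    {v w : ℝ≥0} (hv : v ≠ 0) :
    ∫⁻ p : (Fin L → Fin N → ℂ) × (Fin L → ℂ),
        ‖(WithLp.toLp 2 (pinv (Matrix.of p.1) *ᵥ p.2) : EuclideanSpace ℂ (Fin N))‖ₑ ^ 2
        ∂(Measure.pi fun _ : Fin L => complexGaussianVector (Fin N) v).prod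
          (complexGaussianVector (Fin L) w) ≤
      ENNReal.ofReal (w * (L / (v * m))) := by
  have hpm := measurable_pinv (m := Fin L) (n := Fin N)
  have hpm' : ∀ l i, Measurable fun A : Fin L → Fin N → ℂ => pinv (Matrix.of A) l i := fun l i =>
    (measurable_pi_apply i).comp ((measurable_pi_apply l).comp hpm)
  have hmeas := measurable_pinv_mulVec (m := Fin L) (n := Fin N)
  rw [lintegral_prod _ (hmeas.enorm.pow_const 2).aemeasurable]
  simp_rw [lintegral_enorm_mulVec_sq]
  rw [lintegral_const_mul _ (by fun_prop), lintegral_finsetSum _ fun i _ => by fun_prop]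
  calc _ ≤ (w : ℝ≥0∞) * ∑ _i : Fin L, ENNReal.ofReal (1 / (v * m)) := by
        gcongr with i
        exact lintegral_sum_enorm_pinv_sq_le hm hmN hv i
    _ = _ := by
        rw [Finset.sum_const, Finset.card_univ, Fintype.card_fin, nsmul_eq_mul,
          ENNReal.ofReal_mul (by positivity), ENNReal.ofReal_coe_nnreal, ← ENNReal.ofReal_natCast,
          ← ENNReal.ofReal_mul (by positivity), mul_one_div]

/-- Jensen's inequality for the square, with integrability. -/
theorem integrable_and_integral_norm_le_sqrt {Ω E : Type*} [MeasurableSpace Ω] {P : Measure Ω}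
    [IsProbabilityMeasure P] [NormedAddCommGroup E] {f : Ω → E} (hf : AEStronglyMeasurable f P)
    {C : ℝ} (hC : 0 ≤ C) (h : ∫⁻ ω, ‖f ω‖ₑ ^ 2 ∂P ≤ ENNReal.ofReal C) :
    Integrable (fun ω => ‖f ω‖) P ∧ ∫ ω, ‖f ω‖ ∂P ≤ √C := by
  have h2 : eLpNorm f 2 P ≤ ENNReal.ofReal √C := by
    rw [eLpNorm_eq_lintegral_rpow_enorm_toReal (by norm_num) (by norm_num)]
    simp only [ENNReal.toReal_ofNat, ENNReal.rpow_ofNat]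
    rw [Real.sqrt_eq_rpow, ← ENNReal.ofReal_rpow_of_nonneg hC (by norm_num)]
    exact ENNReal.rpow_le_rpow h (by norm_num)
  have h1 : eLpNorm f 1 P ≤ ENNReal.ofReal √C :=
    (eLpNorm_le_eLpNorm_of_exponent_le (by norm_num) hf).trans h2
  have hi : Integrable f P := memLp_one_iff_integrable.1 ⟨hf, h1.trans_lt ENNReal.ofReal_lt_top⟩
  refine ⟨hi.norm, ?_⟩
  rw [eLpNorm_one_eq_lintegral_enorm, ← ofReal_integral_norm_eq_lintegral_enorm hi] at h1
  exact (ENNReal.ofReal_le_ofReal_iff (Real.sqrt_nonneg _)).1 h1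

theorem theorem4 {Ω : Type*} [MeasurableSpace Ω] (P : Measure Ω) [IsProbabilityMeasure P]
    (L N : ℕ) (hLN : L + 1 < N) (σ₁ σ₂ : ℝ≥0) (hσ₁ : 0 < σ₁)
    (G : Ω → Matrix (Fin L) (Fin N) ℂ) (x : Ω → Fin L → ℂ)
    (hG_law : ∀ i j, HasLaw (fun ω => G ω i j) (complexGaussian (σ₁ ^ 2)) P)
    (hG_indep : iIndepFun (fun (p : Fin L × Fin N) ω => G ω p.1 p.2) P)
    (hx_law : HasLaw x (complexGaussianVector (Fin L) (σ₂ ^ 2)) P)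
    (hGx_indep : IndepFun (fun ω (p : Fin L × Fin N) => G ω p.1 p.2) x P) :
    Integrable (fun ω => ‖(WithLp.toLp 2 (pinv (G ω) *ᵥ x ω) : EuclideanSpace ℂ (Fin N))‖) P ∧
      ∫ ω, ‖(WithLp.toLp 2 (pinv (G ω) *ᵥ x ω) : EuclideanSpace ℂ (Fin N))‖ ∂P ≤
        Real.sqrt ((L : ℝ) / ((N : ℝ) - (L : ℝ) - 1)) * ((σ₂ : ℝ) / (σ₁ : ℝ)) := by
  -- `m = N - L - 1` gives the stated constant; `m = N - L` would satisfy the same lemmas.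
  obtain ⟨m, rfl⟩ : ∃ m, N = L + 1 + m := ⟨N - (L + 1), by omega⟩
  have hm : m ≠ 0 := by omega
  have hσ : (0 : ℝ) < σ₁ := by exact_mod_cast hσ₁
  let μ := Measure.pi fun _ : Fin L => complexGaussianVector (Fin (L + 1 + m)) (σ₁ ^ 2)
  let curry : (Fin L × Fin (L + 1 + m) → ℂ) → Fin L → Fin (L + 1 + m) → ℂ := fun f i j => f (i, j)
  have hcurry : Measurable curry := by fun_prop
  have hG : HasLaw (fun ω i j => G ω i j) μ P := by
    have h1 := hG_indep.hasLaw_pi fun p : Fin L × Fin (L + 1 + m) => hG_law p.1 p.2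
    refine ⟨hcurry.comp_aemeasurable h1.aemeasurable, ?_⟩
    have h2 := AEMeasurable.map_map_of_aemeasurable hcurry.aemeasurable h1.aemeasurable
    rw [h1.map_eq, map_curry_pi] at h2
    exact h2.symm
  have hind : IndepFun (fun ω i j => G ω i j) x P := hGx_indep.comp hcurry measurable_id
  have hlaw : HasLaw (fun ω => ((fun i j => G ω i j : Fin L → Fin (L + 1 + m) → ℂ), x ω))
      (μ.prod (complexGaussianVector (Fin L) (σ₂ ^ 2))) P := by
    refine ⟨hG.aemeasurable.prodMk hx_law.aemeasurable, ?_⟩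
    rw [(indepFun_iff_map_prod_eq_prod_map_map hG.aemeasurable hx_law.aemeasurable).1 hind,
      hG.map_eq, hx_law.map_eq]
  have hmeas := measurable_pinv_mulVec (m := Fin L) (n := Fin (L + 1 + m))
  have hbound := lintegral_enorm_pinv_mulVec_sq_le (w := σ₂ ^ 2) hm
    (show L + m ≤ L + 1 + m by omega) (pow_ne_zero 2 hσ₁.ne')
  rw [← hlaw.lintegral_comp (hmeas.enorm.pow_const 2).aemeasurable] at hbound
  have h := integrable_and_integral_norm_le_sqrt
    (hmeas.comp_aemeasurable hlaw.aemeasurable).aestronglyMeasurable (by positivity) hbound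
  refine ⟨h.1, h.2.trans_eq ?_⟩
  rw [show (L : ℝ) / ((L + 1 + m : ℕ) - L - 1) = L / m by push_cast; ring_nf,
    ← Real.sqrt_sq (show (0 : ℝ) ≤ σ₂ / σ₁ by positivity), ← Real.sqrt_mul (by positivity)]
  congr 1
  push_cast
  field_simp
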